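/- Let $\mathsf{SumToInfinity} = \{w_0w_1\ldots\in\mathbb Z^\omega \mid \lim_{k\to\infty}\sum_{i=0}^{k-1} w_i = +\infty\}$, where $\mathbb Z^\omega$ carries the product of the discrete topologies. Then: (i) $\mathsf{SumToInfinity}$ is $\mathbf{\Pi}^0_3$-complete: it belongs to the class $\mathbf{\Pi}^0_3$ of the Borel hierarchy of $\mathbb Z^\omega$, and for every zero-dimensional Polish space $X$ and every $\mathbf{\Pi}^0_3$ set $B\subseteq X$ there is a continuous map $f\colon X\to\mathbb Z^\omega$ with $f^{-1}(\mathsf{SumToInfinity})=B$. (ii) $\mathsf{SumToInfinity}$ is positional: let $G$ be any directed graph, of arbitrary cardinality, with edges labelled by integers, in which every vertex has an outgoing edge and every vertex belongs to one of two players, Eve or Adam. Starting from some vertex, a token is moved forever along edges, the owner of the current vertex choosing the edge, and Eve wins if the infinite word of labels is in $\mathsf{SumToInfinity}$. Then Eve has a single strategy that chooses the next edge depending only on the current vertex and that is winning from every vertex from which she has some winning strategy. -/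

import Mathlib

open Filter TopologicalSpace

/-! ### The finite levels of the Borel hierarchy -/

/-- `IsSigma0 n A`: the set `A` belongs to the class `Σ⁰ₙ` (`n ≥ 1`). The class `Σ⁰₁` consists of
the open sets; a set is in `Σ⁰ₙ₊₁` if it is a countable union of sets each of which is
in `Π⁰ₘ` (that is, has its complement in `Σ⁰ₘ`) for some `1 ≤ m ≤ n`. -/
inductive IsSigma0 {X : Type*} [TopologicalSpace X] : ℕ → Set X → Prop
  | isOpen (A : Set X) (hA : IsOpen A) : IsSigma0 1 A
  | iUnion (n : ℕ) (m : ℕ → ℕ) (A : ℕ → Set X) (hm : ∀ i, 1 ≤ m i ∧ m i ≤ n)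
      (hA : ∀ i, IsSigma0 (m i) (A i)ᶜ) : IsSigma0 (n + 1) (⋃ i, A i)

/-- `IsPi0 n A`: the set `A` belongs to the class `Π⁰ₙ`, i.e. its complement is in `Σ⁰ₙ`. -/
def IsPi0 {X : Type*} [TopologicalSpace X] (n : ℕ) (A : Set X) : Prop :=
  IsSigma0 n Aᶜ

/-- A continuous reduction of `B ⊆ X` to `A ⊆ Y`. -/
def ContinuouslyReducible {X Y : Type*} [TopologicalSpace X] [TopologicalSpace Y]
    (B : Set X) (A : Set Y) : Prop :=
  ∃ f : X → Y, Continuous f ∧ f ⁻¹' A = B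

/-- `A` is `Π⁰ₙ`-hard: every `Π⁰ₙ` subset of every zero-dimensional Polish space reduces
continuously to `A`. -/
def IsPi0Hard.{u, v} {Y : Type v} [TopologicalSpace Y] (n : ℕ) (A : Set Y) : Prop :=
  ∀ (X : Type u) [TopologicalSpace X] [PolishSpace X],
    IsTopologicalBasis {s : Set X | IsClopen s} →
      ∀ B : Set X, IsPi0 n B → ContinuouslyReducible B A

/-- `A` is `Π⁰ₙ`-complete: it is in `Π⁰ₙ` and it is `Π⁰ₙ`-hard. -/
def IsPi0Complete.{u, v} {Y : Type v} [TopologicalSpace Y] (n : ℕ) (A : Set Y) : Prop :=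
  IsPi0 n A ∧ IsPi0Hard.{u, v} n A

/-! ### Games on graphs -/

/-- A game graph with vertex set `V` and edges labelled by `C`: the vertices in `eve` belong to
Eve, all others to Adam. Every vertex has an outgoing edge, so that plays are infinite. -/
structure GameGraph (C V : Type*) where
  eve : Set V
  edge : V → C → V → Prop
  no_sink : ∀ v, ∃ c v', edge v c v'

namespace GameGraph

variable {C V : Type*}

/-- An infinite path: the sequence of its vertices and the sequence of its labels. -/
structure Play (G : GameGraph C V) where
  vertex : ℕ → V
  label : ℕ → C
  edge_mem : ∀ i, G.edge (vertex i) (label i) (vertex (i + 1))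

/-- The moves made before time `i`: the list of pairs (source, label) of the first `i` edges.
Together with the vertex at time `i` this determines the path followed so far. -/
def Play.history {G : GameGraph C V} (p : G.Play) (i : ℕ) : List (V × C) :=
  (List.range i).map fun j => (p.vertex j, p.label j)

/-- A strategy of Eve: given the past moves and the current vertex, if that vertex is Eve's, it
chooses an outgoing edge (a label and a target). Values elsewhere are irrelevant. -/
structure Strategy (G : GameGraph C V) where
  choice : List (V × C) → V → C × V
  legal : ∀ h v, v ∈ G.eve → G.edge v (choice h v).1 (choice h v).2

/-- The strategy does not depend on the past moves, only on the current vertex. -/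
def Strategy.IsPositional {G : GameGraph C V} (σ : G.Strategy) : Prop :=
  ∀ h h' : List (V × C), ∀ v ∈ G.eve, σ.choice h v = σ.choice h' v

/-- The play follows the strategy at all vertices of Eve. -/
def Play.ConsistentWith {G : GameGraph C V} (p : G.Play) (σ : G.Strategy) : Prop :=
  ∀ i, p.vertex i ∈ G.eve → (p.label i, p.vertex (i + 1)) = σ.choice (p.history i) (p.vertex i)

/-- The strategy is winning from `v` for the objective `W`: every play from `v` that is
consistent with it is labelled by a word in `W`. -/
def Strategy.WinsFrom {G : GameGraph C V} (σ : G.Strategy) (W : Set (ℕ → C)) (v : V) : Prop :=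
  ∀ p : G.Play, p.vertex 0 = v → p.ConsistentWith σ → p.label ∈ W

end GameGraph

/-- The objective `W` is positional: on every game graph, there is a single positional strategy
of Eve that is winning from every vertex from which she has some winning strategy. -/
def IsPositionalObjective.{u, v} {C : Type v} (W : Set (ℕ → C)) : Prop :=
  ∀ (V : Type u) (G : GameGraph C V), ∃ σ : G.Strategy, σ.IsPositional ∧
    ∀ v : V, (∃ τ : G.Strategy, τ.WinsFrom W v) → σ.WinsFrom W v

/-- The integer sequences whose partial sums tend to `+∞`. -/
def SumToInfinity : Set (ℕ → ℤ) :=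
  {w | Tendsto (fun k => ∑ i ∈ Finset.range k, w i) atTop atTop}

universe u v

/-!
For `Π⁰₃`-hardness, a `Π⁰₃` set `B` of a zero-dimensional space is written as `⋂ i, S i` with each
`S i` a countable union of closed sets. Testing the closed sets of one `S i` one after the other
yields a sequence of clopen events of which only finitely many occur at `x` iff `x ∈ S i`
(`exists_isClopen_mem_iff_eventually`). The reduction takes, as its `n`-th partial sum at `x`, the
least `i` whose event occurs at time `n`, or `n` if there is no such `i < n`; this tends to `+∞`
iff each event occurs finitely often, that is iff `x ∈ B`.

For positionality, fix a winning strategy `τ` from `v`. For each `n`, all plays have finitely many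
partial sums `≤ n`, so the number of visits to sums `≤ n` is bounded by an ordinal rank `α n`
(`exists_visitRank`). Along an edge with label `c`, the rank `α' (n - c)` of the residual strategy
is at most `α n`, and smaller than `α n` if `n ≥ 0`, since the current position has sum `0`. The
sequences `α` are monotone in `n : ℤ` and are compared lexicographically, starting from `-∞`. This
comparison is well-founded on every half-line `(-∞, N]`, because a monotone sequence of ordinals
is constant near `-∞`. Hence there is an infimum `A v` over all strategies that win from `v`, and
each truncation of it is attained (`exists_lex_infimum`).

The positional strategy plays at `v` the first move of a winning strategy that attains `A v` on
`(-∞, 0]`. In any play consistent with it, with partial sums `σ k`, the sequences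
`n ↦ A (v k) (n - σ k)` decrease strictly at step `k` on `(-∞, σ k]`. So on a fixed `(-∞, N]` they
never increase and decrease strictly whenever `σ k ≤ N`, which happens only finitely often
(`tendsto_atTop_of_lexLT`).
-/

/-! ### The Borel class of `SumToInfinity` -/

theorem sumToInfinity_isPi0_three : IsPi0 3 SumToInfinity := by
  have hcont : ∀ k : ℕ, Continuous fun w : ℕ → ℤ => ∑ i ∈ Finset.range k, w i :=
    fun k => continuous_finsetSum _ fun i _ => continuous_apply i
  have hC : SumToInfinityᶜ = ⋃ N : ℕ, {w : ℕ → ℤ |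
      ∀ᶠ k in atTop, (N : ℤ) ≤ ∑ i ∈ Finset.range k, w i}ᶜ := by
    rw [← Set.compl_iInter]
    congr 1
    ext w
    simp only [SumToInfinity, Set.mem_ofPred_eq, Set.mem_iInter]
    refine ⟨fun h N => h.eventually_ge_atTop _, fun h => tendsto_atTop.2 fun b => ?_⟩
    exact (h b.toNat).mono fun k hk => (Int.self_le_toNat b).trans hk
  unfold IsPi0
  rw [hC]
  refine IsSigma0.iUnion 2 (fun _ => 2) _ (fun _ => by norm_num) fun N => ?_
  have hU : {w : ℕ → ℤ | ∀ᶠ k in atTop, (N : ℤ) ≤ ∑ i ∈ Finset.range k, w i}ᶜᶜ =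
      ⋃ M : ℕ, ⋂ k ≥ M, {w : ℕ → ℤ | (N : ℤ) ≤ ∑ i ∈ Finset.range k, w i} := by
    ext w
    simp [eventually_atTop]
  rw [hU]
  refine IsSigma0.iUnion 1 (fun _ => 1) _ (fun _ => by norm_num) fun M => ?_
  refine IsSigma0.isOpen _ (IsClosed.isOpen_compl (self := ?_))
  exact isClosed_biInter fun k _ => isClosed_le continuous_const (hcont k)

/-! ### Hardness for `Π⁰₃` -/

theorem IsSigma0.isOpen_or_eq_iUnion {X : Type*} [TopologicalSpace X] {k : ℕ} {A : Set X}
    (h : IsSigma0 k A) : (k = 1 ∧ IsOpen A) ∨ ∃ (n : ℕ) (m : ℕ → ℕ) (F : ℕ → Set X),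
      k = n + 1 ∧ (∀ i, 1 ≤ m i ∧ m i ≤ n) ∧ (∀ i, IsSigma0 (m i) (F i)ᶜ) ∧ A = ⋃ i, F i := by
  cases h with
  | isOpen _ hA => exact Or.inl ⟨rfl, hA⟩
  | iUnion n m F hm hF => exact Or.inr ⟨n, m, F, rfl, hm, hF, rfl⟩

theorem IsSigma0.isOpen_of_one {X : Type*} [TopologicalSpace X] {A : Set X}
    (h : IsSigma0 1 A) : IsOpen A := by
  rcases h.isOpen_or_eq_iUnion with ⟨-, h⟩ | ⟨n, m, F, hn, hm, -⟩
  · exact h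
  · have := hm 0
    omega

section ZeroDimensional

variable {X : Type*} [TopologicalSpace X]

theorem exists_eq_iUnion_isClopen [SecondCountableTopology X]
    (hX : IsTopologicalBasis {s : Set X | IsClopen s}) {U : Set X} (hU : IsOpen U) :
    ∃ C : ℕ → Set X, (∀ n, IsClopen (C n)) ∧ U = ⋃ n, C n := by
  obtain ⟨S, hS, rfl⟩ := hX.open_eq_sUnion hU
  obtain ⟨T, hT, hTS, hTU⟩ := isOpen_sUnion_countable S fun s hs => (hS hs).isOpen
  obtain ⟨C, hC⟩ := (hT.insert ∅).exists_eq_range (Set.insert_nonempty _ _)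
  refine ⟨C, fun n => ?_, ?_⟩
  · rcases (hC ▸ Set.mem_range_self n : C n ∈ insert ∅ T) with h | h
    · rw [h]
      exact isClopen_empty
    · exact hS (hTS h)
  · rw [← Set.sUnion_range, ← hC, Set.sUnion_insert, Set.empty_union, hTU]

theorem IsClopen.continuous_ite {Y : Type*} [TopologicalSpace Y] {s : Set X} (hs : IsClopen s)
    [DecidablePred (· ∈ s)] {f g : X → Y} (hf : Continuous f) (hg : Continuous g) :
    Continuous fun x => if x ∈ s then f x else g x :=
  hf.if (fun a ha => by
    have h : a ∈ frontier s := ha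
    simp [hs.frontier_eq] at h) hg

theorem isClopen_setOf_mem_apply {k : X → ℕ} (hk : Continuous k) {D : ℕ → Set X}
    (hD : ∀ j, IsClopen (D j)) : IsClopen {x | x ∈ D (k x)} := by
  have key : ∀ E : ℕ → Set X, (∀ j, IsOpen (E j)) → IsOpen {x | x ∈ E (k x)} := by
    intro E hE
    have : {x | x ∈ E (k x)} = ⋃ j, k ⁻¹' {j} ∩ E j := by
      ext x
      simp
    rw [this]
    exact isOpen_iUnion fun j => ((isOpen_discrete _).preimage hk).inter (hE j)
  exact ⟨⟨key (fun j => (D j)ᶜ) fun j => (hD j).compl.isOpen⟩, key D fun j => (hD j).isOpen⟩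

open Classical in
/-- The counter attached to sets `D j n`, where `x ∈ D j n` means that by time `n` the point `x`
has been seen to be outside the `j`-th closed set. The counter holds the index of the closed set
under test and passes to the next index as soon as the test fails. -/
noncomputable def refutationCounter (D : ℕ → ℕ → Set X) : ℕ → X → ℕ
  | 0, _ => 0
  | n + 1, x => if x ∈ D (refutationCounter D n x) n then refutationCounter D n x + 1
      else refutationCounter D n x

theorem continuous_refutationCounter {D : ℕ → ℕ → Set X} (hD : ∀ j n, IsClopen (D j n)) (n : ℕ) :
    Continuous (refutationCounter D n) := by
  induction n with
  | zero => exact continuous_const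
  | succ n ih =>
    classical
    have h := isClopen_setOf_mem_apply ih fun j => hD j n
    convert h.continuous_ite (ih.add (continuous_const (y := 1))) ih using 2
    simp only [refutationCounter, Set.mem_ofPred_eq, Pi.add_apply]

/-- An `F_σ` set is the set of points at which only finitely many of a sequence of clopen events
occur; the events are the increments of the counter. -/
theorem exists_isClopen_mem_iff_eventually [SecondCountableTopology X]
    (hX : IsTopologicalBasis {s : Set X | IsClopen s}) {F : ℕ → Set X}
    (hF : ∀ j, IsClosed (F j)) :
    ∃ e : ℕ → Set X, (∀ n, IsClopen (e n)) ∧ ∀ x, x ∈ ⋃ j, F j ↔ ∀ᶠ n in atTop, x ∉ e n := by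
  choose C hC hFC using fun j => exists_eq_iUnion_isClopen hX (hF j).isOpen_compl
  let D : ℕ → ℕ → Set X := fun j n => ⋃ i ∈ Finset.range (n + 1), C j i
  have hD : ∀ j n, IsClopen (D j n) := fun j n => isClopen_biUnion_finset fun i _ => hC j i
  have hFD : ∀ j x, x ∈ F j ↔ ∀ n, x ∉ D j n := by
    intro j x
    have : x ∉ F j ↔ ∃ n, x ∈ C j n := by
      rw [← Set.mem_compl_iff, hFC j, Set.mem_iUnion]
    rw [← not_iff_not, this]
    simp only [D, Set.mem_iUnion, not_forall, not_not, Finset.mem_range]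
    exact ⟨fun ⟨n, h⟩ => ⟨n, n, by omega, h⟩, fun ⟨_, i, _, h⟩ => ⟨i, h⟩⟩
  have hDmono : ∀ j x n n', n ≤ n' → x ∈ D j n → x ∈ D j n' := by
    intro j x n n' hn hx
    simp only [D, Set.mem_iUnion, Finset.mem_range] at hx ⊢
    obtain ⟨i, hi, hx⟩ := hx
    exact ⟨i, by omega, hx⟩
  refine ⟨fun n => {x | x ∈ D (refutationCounter D n x) n}, fun n =>
    isClopen_setOf_mem_apply (continuous_refutationCounter hD n) fun j => hD j n, fun x => ?_⟩
  have hmono : Monotone fun n => refutationCounter D n x := by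
    refine monotone_nat_of_le_succ fun n => ?_
    simp only [refutationCounter]
    split_ifs <;> omega
  simp only [Set.mem_iUnion, Set.mem_ofPred_eq]
  constructor
  · rintro ⟨j, hj⟩
    have hbound : ∀ n, refutationCounter D n x ≤ j := by
      intro n
      induction n with
      | zero => exact Nat.zero_le _
      | succ n ih =>
        simp only [refutationCounter]
        split_ifs with h
        · rcases ih.lt_or_eq with h' | h'
          · exact h'
          · exact absurd (h' ▸ h) ((hFD j x).1 hj n)
        · exact ih
    by_contra hfreq
    have hunb : ∀ b, ∃ n, b ≤ refutationCounter D n x := by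
      intro b
      induction b with
      | zero => exact ⟨0, Nat.zero_le _⟩
      | succ b ih =>
        obtain ⟨n, hn⟩ := ih
        rw [not_eventually] at hfreq
        obtain ⟨n', hn', h⟩ := frequently_atTop.1 hfreq n
        refine ⟨n' + 1, ?_⟩
        simp only [refutationCounter]
        rw [if_pos (not_not.1 h)]
        exact Nat.succ_le_succ (hn.trans (hmono hn'))
    obtain ⟨n, hn⟩ := hunb (j + 1)
    have := hbound n
    omega
  · intro h
    obtain ⟨n₀, hn₀⟩ := eventually_atTop.1 h
    have hconst : ∀ n, n₀ ≤ n → refutationCounter D n x = refutationCounter D n₀ x := by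
      intro n hn
      induction n, hn using Nat.le_induction with
      | base => rfl
      | succ n hn ih =>
        rw [← ih]
        simp only [refutationCounter]
        exact if_neg (hn₀ n hn)
    refine ⟨refutationCounter D n₀ x, (hFD _ x).2 fun n hn => ?_⟩
    have h1 := hn₀ (max n n₀) (le_max_right _ _)
    rw [hconst _ (le_max_right _ _)] at h1
    exact h1 (hDmono _ _ _ _ (le_max_left _ _) hn)

theorem IsSigma0.exists_isClosed_iUnion [SecondCountableTopology X]
    (hX : IsTopologicalBasis {s : Set X | IsClopen s}) {k : ℕ} (hk : k ≤ 2) {A : Set X}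
    (hA : IsSigma0 k A) : ∃ F : ℕ → Set X, (∀ j, IsClosed (F j)) ∧ A = ⋃ j, F j := by
  rcases hA.isOpen_or_eq_iUnion with ⟨-, h⟩ | ⟨n, m, F, hn, hm, hF, rfl⟩
  · obtain ⟨C, hC, rfl⟩ := exists_eq_iUnion_isClopen hX h
    exact ⟨C, fun n => (hC n).isClosed, rfl⟩
  · refine ⟨F, fun i => ?_, rfl⟩
    have h1 : m i = 1 := by
      have := hm i
      omega
    exact ⟨(h1 ▸ hF i : IsSigma0 1 (F i)ᶜ).isOpen_of_one⟩

theorem continuouslyReducible_sumToInfinity [SecondCountableTopology X]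
    (hX : IsTopologicalBasis {s : Set X | IsClopen s}) {B : Set X} (hB : IsPi0 3 B) :
    ContinuouslyReducible B SumToInfinity := by
  classical
  have hev : ∃ e : ℕ → ℕ → Set X, (∀ i n, IsClopen (e i n)) ∧
      ∀ x, x ∈ B ↔ ∀ i, ∀ᶠ n in atTop, x ∉ e i n := by
    rcases IsSigma0.isOpen_or_eq_iUnion hB with ⟨h, -⟩ | ⟨n, m, S, hn, hm, hS, hBS⟩
    · omega
    · choose F hF hSF using fun i =>
        (hS i).exists_isClosed_iUnion hX ((hm i).2.trans (by omega))
      choose e he hFe using fun i => exists_isClopen_mem_iff_eventually hX (hF i)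
      refine ⟨e, he, fun x => ?_⟩
      rw [← compl_compl B, hBS, Set.compl_iUnion, Set.mem_iInter]
      exact forall_congr' fun i => by rw [hSF i, hFe i]
  obtain ⟨e, he, hBe⟩ := hev
  -- The events with index at most `j`, so that `E j n` increases with `j`.
  let E : ℕ → ℕ → Set X := fun j n => ⋃ i ∈ Finset.range (j + 1), e i n
  have hE : ∀ j n, IsClopen (E j n) := fun j n => isClopen_biUnion_finset fun i _ => he i n
  -- `s n x` is the least index of an event occurring at time `n`, and `n` if there is none
  -- below `n`.
  let s : ℕ → X → ℤ := fun n x => ∑ j ∈ Finset.range n, if x ∈ E j n then 0 else 1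
  have hs : ∀ n, Continuous (s n) := fun n =>
    continuous_finsetSum _ fun j _ =>
      (hE j n).continuous_ite continuous_const continuous_const
  refine ⟨fun x n => s (n + 1) x - s n x, continuous_pi fun n => (hs _).sub (hs _), ?_⟩
  ext x
  have hsum : ∀ k, ∑ i ∈ Finset.range k, (s (i + 1) x - s i x) = s k x := by
    intro k
    rw [Finset.sum_range_sub (fun n => s n x)]
    simp [s]
  simp only [SumToInfinity, Set.mem_preimage, Set.mem_ofPred_eq, hsum, hBe]
  constructor
  · intro h i
    filter_upwards [h.eventually_ge_atTop ((i : ℤ) + 1)] with n hn hx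
    have hle : s n x ≤ ∑ j ∈ Finset.range n, if j < i then 1 else 0 := by
      refine Finset.sum_le_sum fun j _ => ?_
      by_cases hj : j < i
      · rw [if_pos hj]
        split_ifs <;> norm_num
      · rw [if_neg hj, if_pos]
        simp only [E, Set.mem_iUnion, Finset.mem_range]
        exact ⟨i, by omega, hx⟩
    have hcard : (∑ j ∈ Finset.range n, if j < i then (1 : ℤ) else 0) ≤ i := by
      rw [Finset.sum_boole]
      have : (Finset.range n).filter (· < i) ⊆ Finset.range i := by
        intro j
        simp
      exact_mod_cast (Finset.card_le_card this).trans (Finset.card_range i).le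
    omega
  · intro h
    refine tendsto_atTop.2 fun b => ?_
    have h1 : ∀ᶠ n in atTop, ∀ i ∈ Finset.range b.toNat, x ∉ e i n :=
      (eventually_all_finset _).2 fun i _ => h i
    filter_upwards [h1, eventually_ge_atTop b.toNat] with n hn hbn
    refine (Int.self_le_toNat b).trans ?_
    have hle : ∑ j ∈ Finset.range b.toNat, (if x ∈ E j n then (0 : ℤ) else 1) ≤ s n x :=
      Finset.sum_le_sum_of_subset_of_nonneg (Finset.range_mono hbn) fun j _ _ => by
        split_ifs <;> norm_num
    refine le_trans (le_of_eq ?_) hle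
    rw [Finset.sum_congr rfl (g := fun _ => (1 : ℤ))]
    · simp
    · intro j hj
      refine if_neg fun hx => ?_
      simp only [E, Set.mem_iUnion, Finset.mem_range] at hx hj
      obtain ⟨i, hi, hx⟩ := hx
      exact hn i (Finset.mem_range.2 (by omega)) hx

end ZeroDimensional

/-! ### Infinite paths through a recurrent set -/

/-- There is an `r`-path of length exactly `n` from `x` into `B`. -/
def ReachesIn {X : Type*} (r : X → X → Prop) (B : Set X) : ℕ → X → Prop
  | 0, x => x ∈ B
  | n + 1, x => ∃ y, r x y ∧ ReachesIn r B n y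

theorem exists_reachesIn_of_transGen {X : Type*} {r : X → X → Prop} {B : Set X} {x b : X}
    (h : Relation.TransGen r x b) (hb : b ∈ B) : ∃ n, ReachesIn r B (n + 1) x := by
  induction h using Relation.TransGen.head_induction_on with
  | single h => exact ⟨0, b, h, hb⟩
  | head h _ ih =>
    obtain ⟨n, hn⟩ := ih
    exact ⟨n + 1, _, h, hn⟩

theorem exists_path_frequently_mem {X : Type*} {r : X → X → Prop} {B : Set X}
    (hB : ∀ b ∈ B, ∃ b' ∈ B, Relation.TransGen r b b') {b₀ : X} (hb₀ : b₀ ∈ B) :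
    ∃ g : ℕ → X, (∀ i, r (g i) (g (i + 1))) ∧ ∃ᶠ i in atTop, g i ∈ B := by
  -- Walk on pairs of a point and the length of a path from it into `B`; the length drops at
  -- every step until it is `0`.
  let S := {p : X × ℕ // ReachesIn r B p.2 p.1}
  have hnext : ∀ p : S, ∃ q : S, r p.1.1 q.1.1 ∧ (p.1.2 = 0 ∨ p.1.2 = q.1.2 + 1) := by
    rintro ⟨⟨x, n⟩, hx⟩
    cases n with
    | zero =>
      obtain ⟨b, hb, hxb⟩ := hB x hx
      obtain ⟨n, y, hxy, hy⟩ := exists_reachesIn_of_transGen hxb hb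
      exact ⟨⟨(y, n), hy⟩, hxy, Or.inl rfl⟩
    | succ n =>
      obtain ⟨y, hxy, hy⟩ := hx
      exact ⟨⟨(y, n), hy⟩, hxy, Or.inr rfl⟩
  choose next hr hlen using hnext
  let g : ℕ → S := fun i => next^[i] ⟨(b₀, 0), hb₀⟩
  have hg : ∀ i, g (i + 1) = next (g i) := fun i => Function.iterate_succ_apply' _ _ _
  refine ⟨fun i => (g i).1.1, fun i => by simpa only [hg] using hr (g i),
    frequently_atTop.2 fun i => ?_⟩
  have key : ∀ n i, (g i).1.2 = n → ∃ j ≥ i, (g j).1.1 ∈ B := by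
    intro n
    induction n with
    | zero =>
      intro i hi
      have := (g i).2
      rw [hi] at this
      exact ⟨i, le_rfl, this⟩
    | succ n ih =>
      intro i hi
      have h := hlen (g i)
      rw [← hg] at h
      obtain ⟨j, hj, hjB⟩ := ih (i + 1) (by omega)
      exact ⟨j, by omega, hjB⟩
  exact key _ i rfl

/-! ### Ordinal ranks on graphs whose paths all sum to infinity -/

section Rank

universe w

variable {X : Type w} (H : X → ℤ → X → Prop)

/-- A step of the graph with labelled edges `H`, with the sum of the labels kept in the second
component. -/
def SumStep (p q : X × ℤ) : Prop := H p.1 (q.2 - p.2) q.1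

/-- `LowBefore H q p`: some nonempty path from `p` to `q` passes, before its end, through a
position of nonpositive sum. -/
def LowBefore (q p : X × ℤ) : Prop :=
  ∃ z : X × ℤ, Relation.ReflTransGen (SumStep H) p z ∧ z.2 ≤ 0 ∧ Relation.TransGen (SumStep H) z q

variable {H}

theorem wellFounded_lowBefore
    (hH : ∀ (x : ℕ → X) (c : ℕ → ℤ), (∀ i, H (x i) (c i) (x (i + 1))) → c ∈ SumToInfinity) :
    WellFounded (LowBefore H) := by
  by_contra hwf
  have hex : ∃ p, ¬ Acc (LowBefore H) p := by
    by_contra h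
    push Not at h
    exact hwf ⟨h⟩
  have hlow : ∀ p, ¬ Acc (LowBefore H) p → ∃ z q, Relation.ReflTransGen (SumStep H) p z ∧
      z.2 ≤ 0 ∧ Relation.TransGen (SumStep H) z q ∧ ¬ Acc (LowBefore H) q := by
    intro p hp
    by_contra h
    refine hp ⟨_, fun q hq => ?_⟩
    obtain ⟨z, hz, hz0, hzq⟩ := hq
    by_contra hq
    exact h ⟨z, q, hz, hz0, hzq, hq⟩
  let B : Set (X × ℤ) :=
    {z | z.2 ≤ 0 ∧ ∃ q, Relation.TransGen (SumStep H) z q ∧ ¬ Acc (LowBefore H) q}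
  have hB : ∀ b ∈ B, ∃ b' ∈ B, Relation.TransGen (SumStep H) b b' := by
    rintro b ⟨-, q, hbq, hq⟩
    obtain ⟨z, q', hqz, hz0, hzq', hq'⟩ := hlow q hq
    exact ⟨z, ⟨hz0, q', hzq', hq'⟩, hbq.trans_left hqz⟩
  obtain ⟨p, hp⟩ := hex
  obtain ⟨z, q, -, hz0, hzq, hq⟩ := hlow p hp
  obtain ⟨g, hg, hfreq⟩ := exists_path_frequently_mem hB (b₀ := z) ⟨hz0, q, hzq, hq⟩
  have hsum := hH (fun i => (g i).1) (fun i => (g (i + 1)).2 - (g i).2) hg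
  simp only [SumToInfinity, Set.mem_ofPred_eq, Finset.sum_range_sub (fun i => (g i).2)] at hsum
  obtain ⟨i, hi, hi'⟩ :=
    (hfreq.and_eventually (hsum.eventually_gt_atTop (-(g 0).2))).exists
  have := hi.1
  omega

theorem SumStep.shift {p q : X × ℤ} (d : ℤ) (h : SumStep H p q) :
    SumStep H (p.1, p.2 - d) (q.1, q.2 - d) := by
  simpa [SumStep] using h

theorem LowBefore.shift {p q : X × ℤ} {d : ℤ} (hd : 0 ≤ d) (h : LowBefore H q p) :
    LowBefore H (q.1, q.2 - d) (p.1, p.2 - d) := by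
  obtain ⟨z, hz, hz0, hzq⟩ := h
  exact ⟨(z.1, z.2 - d), hz.lift (fun p : X × ℤ => (p.1, p.2 - d)) fun _ _ h => h.shift d,
    by simp only; omega, hzq.lift (fun p : X × ℤ => (p.1, p.2 - d)) fun _ _ h => h.shift d⟩

theorem IsWellFounded.rank_le_of_forall {Y : Type w} {r : Y → Y → Prop} [IsWellFounded Y r]
    {a : Y} {o : Ordinal.{w}} (h : ∀ b, r b a → rank r b < o) : rank r a ≤ o := by
  rw [rank_eq]
  exact Ordinal.iSup_le fun b => Order.succ_le_of_lt (h b.1 b.2)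

/-- The ordinal `α x n` measures how often paths from `x` can have partial sums at most `n`. It is
the rank of `(x, -n)` for `LowBefore`: starting with sum `-n` turns the threshold `n` into `0`. -/
theorem exists_visitRank
    (hH : ∀ (x : ℕ → X) (c : ℕ → ℤ), (∀ i, H (x i) (c i) (x (i + 1))) → c ∈ SumToInfinity) :
    ∃ α : X → ℤ → Ordinal.{w}, (∀ x, Monotone (α x)) ∧
      (∀ x c y, H x c y → ∀ n, α y (n - c) ≤ α x n) ∧
      (∀ x c y, H x c y → ∀ n, 0 ≤ n → α y (n - c) < α x n) := by
  have hwf := wellFounded_lowBefore hH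
  have : IsWellFounded _ (LowBefore H) := ⟨hwf⟩
  have hstep : ∀ x c y, H x c y → ∀ n, SumStep H (x, -n) (y, -(n - c)) := by
    intro x c y h n
    have : -(n - c) - -n = c := by ring
    simpa only [SumStep, this] using h
  have hmono : ∀ p : X × ℤ, ∀ d : ℤ, 0 ≤ d →
      IsWellFounded.rank (LowBefore H) (p.1, p.2 + d) ≤ IsWellFounded.rank (LowBefore H) p := by
    intro p
    induction p using hwf.induction with
    | _ p ih =>
      intro d hd
      refine IsWellFounded.rank_le_of_forall fun q hq => ?_
      have h := hq.shift hd
      simp only [add_sub_cancel_right] at h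
      have h1 := ih _ h d hd
      simp only [sub_add_cancel] at h1
      exact h1.trans_lt (IsWellFounded.rank_lt_of_rel h)
  refine ⟨fun x n => IsWellFounded.rank (LowBefore H) (x, -n), fun x n n' hn => ?_,
    fun x c y h n => ?_, fun x c y h n hn => ?_⟩
  · have := hmono (x, -n') (n' - n) (by omega)
    have h : -n' + (n' - n) = -n := by ring
    simpa only [h] using this
  · refine IsWellFounded.rank_le_of_forall fun q hq => IsWellFounded.rank_lt_of_rel ?_
    obtain ⟨z, hz, hz0, hzq⟩ := hq
    exact ⟨z, hz.head (hstep x c y h n), hz0, hzq⟩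
  · exact IsWellFounded.rank_lt_of_rel ⟨_, .refl, by simpa using hn, .single (hstep x c y h n)⟩

end Rank

/-! ### The lexicographic order on sequences of ordinals -/

section Lex

universe w

/-- The strict lexicographic comparison of the restrictions of `a` and `b` to `(-∞, N]`. Asking
only for `≤` before the deciding index covers monotone sequences with different limits at `-∞`,
which have no first index of difference. -/
def LexLT (N : ℤ) (a b : ℤ → Ordinal.{w}) : Prop :=
  ∃ m ≤ N, a m < b m ∧ ∀ k < m, a k ≤ b k

variable {N : ℤ} {a b c : ℤ → Ordinal.{w}}

theorem LexLT.trans (hab : LexLT N a b) (hbc : LexLT N b c) : LexLT N a c := by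
  obtain ⟨m, hm, h1, h2⟩ := hab
  obtain ⟨m', hm', h1', h2'⟩ := hbc
  rcases lt_trichotomy m m' with h | h | h
  · exact ⟨m, hm, h1.trans_le (h2' m h), fun k hk => (h2 k hk).trans (h2' k (hk.trans h))⟩
  · subst h
    exact ⟨m, hm, h1.trans h1', fun k hk => (h2 k hk).trans (h2' k hk)⟩
  · exact ⟨m', hm', (h2 m' h).trans_lt h1', fun k hk => (h2 k (hk.trans h)).trans (h2' k hk)⟩

theorem LexLT.trans_le (hab : LexLT N a b) (hbc : ∀ k ≤ N, b k ≤ c k) : LexLT N a c := by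
  obtain ⟨m, hm, h1, h2⟩ := hab
  exact ⟨m, hm, h1.trans_le (hbc m hm), fun k hk => (h2 k hk).trans (hbc k (hk.le.trans hm))⟩

theorem LexLT.mono {N' : ℤ} (h : LexLT N a b) (hN : N ≤ N') : LexLT N' a b := by
  obtain ⟨m, hm, h⟩ := h
  exact ⟨m, hm.trans hN, h⟩

theorem exists_forall_le_of_monotone (ha : Monotone a) :
    ∃ i ≤ N, ∀ k ≤ i, a k = a i := by
  obtain ⟨o, ⟨i, hi, rfl⟩, hmin⟩ :=
    WellFounded.has_min (wellFounded_lt (α := Ordinal.{w})) (a '' Set.Iic N)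
      ⟨a N, N, Set.self_mem_Iic, rfl⟩
  exact ⟨i, hi, fun k hk => le_antisymm (ha hk)
    (not_lt.1 (hmin _ ⟨k, hk.trans hi, rfl⟩))⟩

theorem LexLT.trichotomous (N : ℤ) (ha : Monotone a) (hb : Monotone b) :
    LexLT N a b ∨ (∀ k ≤ N, a k = b k) ∨ LexLT N b a := by
  by_contra! h
  obtain ⟨h1, ⟨k₀, hk₀, hne⟩, h2⟩ := h
  obtain ⟨i, hi, hai⟩ := exists_forall_le_of_monotone (N := N) ha
  obtain ⟨j, hj, hbj⟩ := exists_forall_le_of_monotone (N := N) hb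
  have hbase : ∀ k ≤ min i j, a k = b k := by
    intro k hk
    have hki := hk.trans (min_le_left _ _)
    have hkj := hk.trans (min_le_right _ _)
    have hconst : ∀ l < k, a l = a k ∧ b l = b k := fun l hl =>
      ⟨(hai l (hl.le.trans hki)).trans (hai k hki).symm,
        (hbj l (hl.le.trans hkj)).trans (hbj k hkj).symm⟩
    rcases lt_trichotomy (a k) (b k) with h | h | h
    · exact absurd ⟨k, hki.trans hi, h, fun l hl => by
        rw [(hconst l hl).1, (hconst l hl).2]; exact h.le⟩ h1
    · exact h
    · exact absurd ⟨k, hki.trans hi, h, fun l hl => by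
        rw [(hconst l hl).1, (hconst l hl).2]; exact h.le⟩ h2
  have hall : ∀ d : ℕ, ∀ k ≤ min i j + d, k ≤ N → a k = b k := by
    intro d
    induction d with
    | zero => exact fun k hk _ => hbase k (by simpa using hk)
    | succ d ih =>
      intro k hk hkN
      have hbelow : ∀ l < k, a l = b l := fun l hl => ih l (by push_cast at hk; omega) (by omega)
      rcases lt_trichotomy (a k) (b k) with h | h | h
      · exact absurd ⟨k, hkN, h, fun l hl => (hbelow l hl).le⟩ h1
      · exact h
      · exact absurd ⟨k, hkN, h, fun l hl => (hbelow l hl).ge⟩ h2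
  exact hne (hall (k₀ - min i j).toNat k₀ (by omega) hk₀)

/-- Lexicographic minima exist on a finite window of indices. -/
theorem exists_lex_minimal_window (i : ℤ) (d : ℕ) {S : Set (ℤ → Ordinal.{w})}
    (hS : S.Nonempty) : ∃ a ∈ S, ∀ b ∈ S, ¬ ∃ m, i < m ∧ m ≤ i + d ∧ b m < a m ∧
      ∀ k, i < k → k < m → b k ≤ a k := by
  induction d with
  | zero =>
    obtain ⟨a, ha⟩ := hS
    refine ⟨a, ha, ?_⟩
    rintro b - ⟨m, h1, h2, -⟩
    push_cast at h2
    omega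
  | succ d ih =>
    let M : Set (ℤ → Ordinal.{w}) := {a | a ∈ S ∧ ∀ b ∈ S, ¬ ∃ m, i < m ∧ m ≤ i + d ∧
      b m < a m ∧ ∀ k, i < k → k < m → b k ≤ a k}
    obtain ⟨a₀, ha₀⟩ : M.Nonempty := ih
    obtain ⟨o, ⟨a, ha, rfl⟩, hmin⟩ := WellFounded.has_min (wellFounded_lt (α := Ordinal.{w}))
      ((fun a => a (i + d + 1)) '' M) ⟨_, a₀, ha₀, rfl⟩
    refine ⟨a, ha.1, ?_⟩
    rintro b hb ⟨m, h1, h2, h3, h4⟩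
    push_cast at h2
    rcases (show m ≤ i + d ∨ m = i + d + 1 by omega) with h | rfl
    · exact ha.2 b hb ⟨m, h1, h, h3, h4⟩
    · refine hmin _ ⟨b, ⟨hb, ?_⟩, rfl⟩ h3
      rintro c hc ⟨m', h1', h2', h3', h4'⟩
      exact ha.2 c hc ⟨m', h1', h2', h3'.trans_le (h4 m' h1' (by omega)),
        fun k hk hk' => (h4' k hk hk').trans (h4 k hk (by omega))⟩

theorem exists_lexLT_minimal (N : ℤ) {S : Set (ℤ → Ordinal.{w})} (hS : S.Nonempty)
    (hmono : ∀ a ∈ S, Monotone a) : ∃ a ∈ S, ∀ b ∈ S, ¬ LexLT N b a := by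
  obtain ⟨a₀, ha₀⟩ := hS
  -- Restrict to the sequences taking at some `i ≤ N` the least value taken by any sequence in
  -- `S` on `(-∞, N]`: by monotonicity they are constant up to `i`.
  obtain ⟨o, ⟨a₁, ha₁, i, hi, rfl⟩, hmin⟩ :=
    WellFounded.has_min (wellFounded_lt (α := Ordinal.{w}))
      {o | ∃ a ∈ S, ∃ i ≤ N, a i = o} ⟨_, a₀, ha₀, N, le_rfl, rfl⟩
  obtain ⟨a, ⟨ha, hai⟩, hamin⟩ := exists_lex_minimal_window i (N - i).toNat
    (S := {a | a ∈ S ∧ a i = a₁ i}) ⟨a₁, ha₁, rfl⟩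
  refine ⟨a, ha, ?_⟩
  rintro b hb ⟨m, hm, hlt, hle⟩
  rcases le_or_gt m i with h | h
  · exact hmin _ ⟨b, hb, m, hm, rfl⟩ (hlt.trans_le ((hmono a ha h).trans hai.le))
  · refine hamin b ⟨hb, le_antisymm ((hle i h).trans hai.le) ?_⟩
      ⟨m, h, by omega, hlt, fun k _ hk => hle k hk⟩
    exact not_lt.1 (hmin _ ⟨b, hb, i, hi, rfl⟩)

/-- A nonempty set of monotone sequences has a lexicographic infimum. It need not belong to the
set, but each of its truncations is the truncation of a member. -/
theorem exists_lex_infimum {S : Set (ℤ → Ordinal.{w})} (hS : S.Nonempty)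
    (hmono : ∀ a ∈ S, Monotone a) : ∃ A : ℤ → Ordinal.{w}, Monotone A ∧
      (∀ N, ∃ a ∈ S, ∀ k ≤ N, a k = A k) ∧
      ∀ N, ∀ a ∈ S, LexLT N A a ∨ ∀ k ≤ N, A k = a k := by
  choose f hfS hfmin using fun N => exists_lexLT_minimal N hS hmono
  have hagree : ∀ N k, k ≤ N → f N k = f k k := by
    intro N k hk
    rcases LexLT.trichotomous k (hmono _ (hfS N)) (hmono _ (hfS k)) with h | h | h
    · exact absurd h (hfmin k _ (hfS N))
    · exact h k le_rfl
    · exact absurd (h.mono hk) (hfmin N _ (hfS k))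
  refine ⟨fun n => f n n, fun k n hkn => ?_, fun N => ⟨f N, hfS N, hagree N⟩, fun N a ha => ?_⟩
  · simpa only [hagree n k hkn] using hmono _ (hfS n) hkn
  · rcases LexLT.trichotomous N (hmono _ (hfS N)) (hmono _ ha) with ⟨m, hm, h1, h2⟩ | h | h
    · exact Or.inl ⟨m, hm, by simpa only [hagree N m hm] using h1, fun k hk => by
        simpa only [hagree N k (hk.le.trans hm)] using h2 k hk⟩
    · exact Or.inr fun k hk => (hagree N k hk).symm.trans (h k hk)
    · exact absurd h (hfmin N a ha)

/-- If the restrictions to `(-∞, σ k]` decrease lexicographically at every step `k`, then `σ`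
tends to `+∞`: those to a fixed `(-∞, N]` never increase, and strictly decrease whenever
`σ k ≤ N`. -/
theorem tendsto_atTop_of_lexLT {b : ℕ → ℤ → Ordinal.{w}} (hmono : ∀ k, Monotone (b k))
    {σ : ℕ → ℤ} (h : ∀ k, LexLT (σ k) (b (k + 1)) (b k)) : Tendsto σ atTop atTop := by
  refine tendsto_atTop.2 fun N => ?_
  let r : {a : ℤ → Ordinal.{w} // Monotone a} → {a : ℤ → Ordinal.{w} // Monotone a} → Prop :=
    fun x y => LexLT N x.1 y.1
  have hwf : WellFounded r := by
    refine WellFounded.wellFounded_iff_has_min.2 fun S hS => ?_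
    obtain ⟨a, ⟨x, hx, rfl⟩, hmin⟩ := exists_lexLT_minimal N (hS.image Subtype.val)
      (by rintro _ ⟨x, -, rfl⟩; exact x.2)
    exact ⟨x, hx, fun y hy => hmin _ ⟨y, hy, rfl⟩⟩
  have : IsWellFounded _ r := ⟨hwf⟩
  let ρ : ℕ → Ordinal := fun k => IsWellFounded.rank r ⟨b k, hmono k⟩
  have hρlt : ∀ k, LexLT N (b (k + 1)) (b k) → ρ (k + 1) < ρ k := fun k hk =>
    IsWellFounded.rank_lt_of_rel hk
  have hρ : Antitone ρ := by
    refine antitone_nat_of_succ_le fun k => ?_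
    obtain ⟨m, hm, h1, h2⟩ := h k
    rcases le_or_gt m N with hmN | hmN
    · exact (hρlt k ⟨m, hmN, h1, h2⟩).le
    · exact IsWellFounded.rank_le_of_forall fun y hy => IsWellFounded.rank_lt_of_rel
        (LexLT.trans_le hy fun l hl => h2 l (hl.trans_lt hmN))
  obtain ⟨o, ⟨k₀, rfl⟩, hmin⟩ := WellFounded.has_min (wellFounded_lt (α := Ordinal))
    (Set.range ρ) ⟨_, 0, rfl⟩
  filter_upwards [eventually_ge_atTop k₀] with k hk
  by_contra hlt
  exact hmin _ ⟨k + 1, rfl⟩ ((hρlt k ((h k).mono (not_le.1 hlt).le)).trans_le (hρ hk))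

end Lex

/-! ### Residual strategies -/

namespace GameGraph

variable {C V : Type*} {G : GameGraph C V}

/-- The strategy `τ` continued after a first move `m`. -/
def Strategy.residual (τ : G.Strategy) (m : V × C) : G.Strategy where
  choice h v := τ.choice (m :: h) v
  legal h v := τ.legal (m :: h) v

/-- One move from `x.2`, compatible with the strategy `x.1`, with the residual strategy at its
end. -/
def ResidualStep (G : GameGraph C V) (x : G.Strategy × V) (c : C) (y : G.Strategy × V) : Prop :=
  G.edge x.2 c y.2 ∧ (x.2 ∈ G.eve → (c, y.2) = x.1.choice [] x.2) ∧ y.1 = x.1.residual (x.2, c)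

/-- The play `p` preceded by the edge from `v` labelled `c`. -/
def Play.cons (p : G.Play) (v : V) (c : C) (h : G.edge v c (p.vertex 0)) : G.Play where
  vertex i := i.casesOn v p.vertex
  label i := i.casesOn c p.label
  edge_mem i := by
    cases i with
    | zero => exact h
    | succ i => exact p.edge_mem i

theorem Play.history_cons (p : G.Play) (v : V) (c : C) (h : G.edge v c (p.vertex 0)) (i : ℕ) :
    (p.cons v c h).history (i + 1) = (v, c) :: p.history i := by
  simp [Play.history, List.range_succ_eq_map, Play.cons]

theorem Play.history_succ (p : G.Play) (i : ℕ) :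
    p.history (i + 1) = p.history i ++ [(p.vertex i, p.label i)] := by
  simp [Play.history, List.range_succ]

/-- Along a path of residual steps, the play is consistent with the initial strategy. -/
theorem consistentWith_of_residualStep {x : ℕ → G.Strategy × V} {c : ℕ → C}
    (h : ∀ i, G.ResidualStep (x i) (c i) (x (i + 1))) :
    (⟨fun i => (x i).2, c, fun i => (h i).1⟩ : G.Play).ConsistentWith (x 0).1 := by
  set p : G.Play := ⟨fun i => (x i).2, c, fun i => (h i).1⟩ with hp
  have key : ∀ i l v, (x i).1.choice l v = (x 0).1.choice (p.history i ++ l) v := by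
    intro i
    induction i with
    | zero => exact fun l v => rfl
    | succ i ih =>
      intro l v
      rw [(h i).2.2, Play.history_succ, List.append_assoc]
      exact ih _ v
  intro i hi
  have := key i [] (x i).2
  rw [List.append_nil] at this
  exact ((h i).2.1 hi).trans this

end GameGraph

theorem cons_mem_sumToInfinity_iff {w w' : ℕ → ℤ} (h : ∀ i, w (i + 1) = w' i) :
    w ∈ SumToInfinity ↔ w' ∈ SumToInfinity := by
  have hsum : ∀ k, ∑ i ∈ Finset.range (k + 1), w i = ∑ i ∈ Finset.range k, w' i + w 0 := by
    intro k
    rw [Finset.sum_range_succ']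
    simp only [h]
  simp only [SumToInfinity, Set.mem_ofPred_eq]
  rw [← tendsto_add_atTop_iff_nat (f := fun k => ∑ i ∈ Finset.range k, w i) 1]
  simp only [hsum]
  refine ⟨fun h => ?_, fun h => tendsto_atTop_add_const_right _ _ h⟩
  simpa using tendsto_atTop_add_const_right _ (-w 0) h

theorem GameGraph.ResidualStep.winsFrom {V : Type*} {G : GameGraph ℤ V} {x y : G.Strategy × V}
    {c : ℤ} (h : G.ResidualStep x c y) (hx : x.1.WinsFrom SumToInfinity x.2) :
    y.1.WinsFrom SumToInfinity y.2 := by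
  intro p hp hcons
  have hedge : G.edge x.2 c (p.vertex 0) := hp ▸ h.1
  refine (cons_mem_sumToInfinity_iff (w := (p.cons x.2 c hedge).label) fun i => rfl).1
    (hx (p.cons x.2 c hedge) rfl fun i hi => ?_)
  cases i with
  | zero =>
    have := h.2.1 hi
    rw [← hp] at this
    exact this
  | succ i =>
    rw [Play.history_cons]
    have := hcons i hi
    rw [h.2.2] at this
    exact this

/-! ### Positionality -/

theorem sumToInfinity_isPositionalObjective : IsPositionalObjective.{v, 0} SumToInfinity := by
  intro V G
  classical
  let X := {x : G.Strategy × V // x.1.WinsFrom SumToInfinity x.2}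
  obtain ⟨α, hαmono, hαle, hαlt⟩ := exists_visitRank (X := X)
    (H := fun x c y => G.ResidualStep x.1 c y.1) fun x c h =>
      (x 0).2 _ rfl (GameGraph.consistentWith_of_residualStep h)
  let win : Set V := {v | ∃ τ : G.Strategy, τ.WinsFrom SumToInfinity v}
  let S : V → Set (ℤ → Ordinal.{v}) := fun v => {a | ∃ x : X, x.1.2 = v ∧ α x = a}
  have hSmono : ∀ v, ∀ a ∈ S v, Monotone a := by
    rintro v a ⟨x, -, rfl⟩
    exact hαmono x
  have hinf : ∀ v : V, ∃ A : ℤ → Ordinal.{v}, v ∈ win → Monotone A ∧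
      (∀ N, ∃ a ∈ S v, ∀ k ≤ N, a k = A k) ∧
      ∀ N, ∀ a ∈ S v, LexLT N A a ∨ ∀ k ≤ N, A k = a k := by
    intro v
    by_cases hv : v ∈ win
    · obtain ⟨τ, hτ⟩ := id hv
      obtain ⟨A, hA⟩ := exists_lex_infimum (S := S v) ⟨_, ⟨(τ, v), hτ⟩, rfl, rfl⟩ (hSmono v)
      exact ⟨A, fun _ => hA⟩
    · exact ⟨0, fun h => absurd h hv⟩
  choose A hA using hinf
  -- A strategy that attains the infimum on the indices `≤ 0`; outside `win`, any strategy.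
  have hopt : ∀ v : V, ∃ τ : G.Strategy, v ∈ win → ∃ h : τ.WinsFrom SumToInfinity v,
      ∀ k ≤ 0, α ⟨(τ, v), h⟩ k = A v k := by
    intro v
    by_cases hv : v ∈ win
    · obtain ⟨a, ⟨⟨⟨τ, v'⟩, hx⟩, rfl, rfl⟩, ha⟩ := (hA v hv).2.1 0
      exact ⟨τ, fun _ => ⟨hx, ha⟩⟩
    · choose e t ht using G.no_sink
      exact ⟨⟨fun _ u => (e u, t u), fun _ u _ => ht u⟩, fun h => absurd h hv⟩
  choose τ hτ using hopt
  refine ⟨⟨fun _ v => (τ v).choice [] v, fun _ v hv => (τ v).legal [] v hv⟩,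
    fun _ _ _ _ => rfl, fun v₀ hv₀ p hp hcons => ?_⟩
  have hstep : ∀ i, G.ResidualStep (τ (p.vertex i), p.vertex i) (p.label i)
      ((τ (p.vertex i)).residual (p.vertex i, p.label i), p.vertex (i + 1)) := fun i =>
    ⟨p.edge_mem i, fun hi => hcons i hi, rfl⟩
  have hwin : ∀ i, p.vertex i ∈ win := by
    intro i
    induction i with
    | zero => exact hp ▸ hv₀
    | succ i ih =>
      obtain ⟨h, -⟩ := hτ _ ih
      exact ⟨_, (hstep i).winsFrom h⟩
  have hlex : ∀ i, LexLT 0 (fun n => A (p.vertex (i + 1)) (n - p.label i)) (A (p.vertex i)) := by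
    intro i
    obtain ⟨h, hτA⟩ := hτ _ (hwin i)
    let y : X := ⟨_, (hstep i).winsFrom h⟩
    have h1 : LexLT 0 (fun n => α y (n - p.label i)) (A (p.vertex i)) :=
      ⟨0, le_rfl, by rw [← hτA 0 le_rfl]; exact hαlt _ _ y (hstep i) 0 le_rfl,
        fun k hk => by rw [← hτA k hk.le]; exact hαle _ _ y (hstep i) k⟩
    rcases (hA _ (hwin (i + 1))).2.2 (-p.label i) (α y) ⟨y, rfl, rfl⟩ with ⟨m, hm, h2, h3⟩ | h2
    · refine LexLT.trans ⟨m + p.label i, by omega, ?_, fun k hk => h3 _ (by omega)⟩ h1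
      simpa using h2
    · obtain ⟨m, hm, h3, h4⟩ := h1
      exact ⟨m, hm, by simpa only [h2 (m - p.label i) (by omega)] using h3, fun k hk => by
        simpa only [h2 (k - p.label i) (by omega)] using h4 k hk⟩
  refine tendsto_atTop_of_lexLT
    (b := fun k n => A (p.vertex k) (n - ∑ i ∈ Finset.range k, p.label i))
    (fun k n n' hn => (hA _ (hwin k)).1 (by omega)) fun k => ?_
  obtain ⟨m, hm, h1, h2⟩ := hlex k
  have hshift : ∀ n, n - ∑ i ∈ Finset.range (k + 1), p.label i =
      (n - ∑ i ∈ Finset.range k, p.label i) - p.label k := by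
    intro n
    rw [Finset.sum_range_succ]
    ring
  refine ⟨m + ∑ i ∈ Finset.range k, p.label i, by omega, ?_, fun n hn => ?_⟩
  · simp only [hshift, add_sub_cancel_right]
    exact h1
  · simp only [hshift]
    exact h2 _ (by omega)

theorem theorem1 :
    IsPi0Complete.{u, 0} 3 SumToInfinity ∧ IsPositionalObjective.{v, 0} SumToInfinity := by
  exact ⟨⟨sumToInfinity_isPi0_three, fun _ _ _ hX _ hB =>
    continuouslyReducible_sumToInfinity hX hB⟩, sumToInfinity_isPositionalObjective⟩
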